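/- For a bounded linear operator $A$ on a complex Hilbert space $H$ let $W(A)=\{\langle Ax,x\rangle : x\in H,\ \|x\|=1\}$ be its numerical range. For an open convex set $\Omega\subset\mathbb C$, $\emptyset\ne\Omega\ne\mathbb C$, define $$C_{cb}(\Omega)=\sup\{\|R(A)\| : \overline{W(A)}\subset\Omega,\ \|R(z)\|\le 1\ \ \forall z\in\Omega\},$$ where the supremum is over all complex Hilbert spaces $H$, all bounded linear operators $A$ on $H$, all integers $m,n$ and all rational functions $R=(r_{ij})$ with values in $\mathbb C^{m\times n}$ (having no poles in $\Omega$) that satisfy the constraints; here $\|R(z)\|$ is the operator norm for the Euclidean norms, and $R(A)=(r_{ij}(A)):H^n\to H^m$ is the block operator between Hilbert direct sums. Define also $$C(\Omega,2)=\sup\{\|r(A)\| : \overline{W(A)}\subset\Omega,\ |r(z)|\le 1\ \ \forall z\in\Omega\},$$ where the supremum is over all complex $2\times2$ matrices $A$, viewed as operators on Euclidean $\mathbb C^2$, and all scalar rational functions $r$ (having no poles in $\Omega$) that satisfy the constraints. Theorem. For the open unit disk $D=\{z\in\mathbb C : |z|<1\}$ one has $$C_{cb}(D)=C(D,2)=2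 .$$ -/

import Mathlib

universe u

open scoped ENNReal

noncomputable section

namespace NumRange

/-- The numerical range `W(A) = {⟨A x, x⟩ ; ‖x‖ = 1}`. The mathematical inner product `⟨A x, x⟩`,
linear in its first argument, is `inner ℂ x (A x)` in Mathlib's convention. -/
def numericalRange {H : Type*} [NormedAddCommGroup H] [InnerProductSpace ℂ H]
    (A : H →L[ℂ] H) : Set ℂ :=
  {w | ∃ x : H, ‖x‖ = 1 ∧ w = inner ℂ x (A x)}

/-- `r` has no pole in `Ω` (the denominator of the reduced fraction does not vanish there). -/
def NoPoleOn (r : RatFunc ℂ) (Ω : Set ℂ) : Prop :=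
  ∀ z ∈ Ω, r.denom.eval z ≠ 0

/-- The value `r(z)` of a rational function at a complex number. -/
def evalAt (r : RatFunc ℂ) (z : ℂ) : ℂ :=
  r.eval (RingHom.id ℂ) z

/-- The operator `r(A) = p(A) q(A)⁻¹`, where `r = p / q` is the reduced fraction; it is used
when `r` has no pole in the spectrum of `A`, so that `q(A)` is invertible. -/
def evalOp {H : Type*} [NormedAddCommGroup H] [InnerProductSpace ℂ H]
    (r : RatFunc ℂ) (A : H →L[ℂ] H) : H →L[ℂ] H :=
  Polynomial.aeval A r.num * Ring.inverse (Polynomial.aeval A r.denom)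

/-- The value `R(z)` of a matrix of rational functions at a complex number. -/
def matEvalAt {m n : ℕ} (R : Matrix (Fin m) (Fin n) (RatFunc ℂ)) (z : ℂ) :
    Matrix (Fin m) (Fin n) ℂ :=
  R.map fun r => evalAt r z

/-- The block operator `R(A) = (R i j (A))` from the Hilbert sum `Hⁿ` to the Hilbert sum `Hᵐ`. -/
def matEvalOp {H : Type*} [NormedAddCommGroup H] [InnerProductSpace ℂ H] {m n : ℕ}
    (R : Matrix (Fin m) (Fin n) (RatFunc ℂ)) (A : H →L[ℂ] H) :
    PiLp 2 (fun _ : Fin n => H) →L[ℂ] PiLp 2 (fun _ : Fin m => H) :=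
  ((PiLp.continuousLinearEquiv 2 ℂ (fun _ : Fin m => H)).symm :
      (Fin m → H) →L[ℂ] PiLp 2 (fun _ : Fin m => H)) ∘L
    ContinuousLinearMap.pi fun i =>
      ∑ j, evalOp (R i j) A ∘L PiLp.proj 2 (fun _ : Fin n => H) j

open scoped Matrix.Norms.L2Operator in
/-- `R` has no pole in `Ω` and `‖R(z)‖ ≤ 1` for all `z ∈ Ω`, where `‖R(z)‖` is the operator norm
of the matrix `R(z)` between Euclidean spaces. -/
def MatBoundedByOneOn {m n : ℕ} (R : Matrix (Fin m) (Fin n) (RatFunc ℂ)) (Ω : Set ℂ) : Prop :=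
  (∀ i j, NoPoleOn (R i j) Ω) ∧ ∀ z ∈ Ω, ‖matEvalAt R z‖ ≤ 1

/-- `C_cb(Ω)`: the supremum of `‖R(A)‖` over all complex Hilbert spaces `H`, all bounded operators
`A` on `H` with `closure W(A) ⊆ Ω`, and all matrix-valued rational functions `R`, of any size,
with `‖R‖ ≤ 1` on `Ω`. -/
def Ccb (Ω : Set ℂ) : ℝ≥0∞ :=
  sSup {c | ∃ (H : Type u) (_ : NormedAddCommGroup H) (_ : InnerProductSpace ℂ H)
    (_ : CompleteSpace H) (A : H →L[ℂ] H) (m n : ℕ) (R : Matrix (Fin m) (Fin n) (RatFunc ℂ)),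
    closure (numericalRange A) ⊆ Ω ∧ MatBoundedByOneOn R Ω ∧ c = ‖matEvalOp R A‖ₑ}

/-- `C(Ω, d)`: the supremum of `‖r(A)‖` over all complex `d × d` matrices `A` (as operators on
Euclidean space) with `closure W(A) ⊆ Ω`, and all rational functions `r` with `|r| ≤ 1` on `Ω`. -/
def C (Ω : Set ℂ) (d : ℕ) : ℝ≥0∞ :=
  sSup {c | ∃ (A : Matrix (Fin d) (Fin d) ℂ) (r : RatFunc ℂ),
    closure (numericalRange (Matrix.toEuclideanCLM (𝕜 := ℂ) A)) ⊆ Ω ∧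
    NoPoleOn r Ω ∧ (∀ z ∈ Ω, ‖evalAt r z‖ ≤ 1) ∧
    c = ‖evalOp r (Matrix.toEuclideanCLM (𝕜 := ℂ) A)‖ₑ}

end NumRange

end

/-! For the upper bound, an operator `A` of numerical radius less than 1 is made a strict
contraction in an equivalent Hilbert metric `⟨N x, x⟩` with `1/2 ≤ N ≤ 2` (`exists_metric`). The
matrix-valued von Neumann inequality in that metric (`sum_inner_metric_le`) gives `½‖R(A)h‖² ≤
2‖h‖²`, hence `‖R(A)‖ ≤ 2` for every matrix size.

The metric comes from a positivity argument in the spirit of Ando's theorem. If `B` has numerical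
radius less than 1, the block Toeplitz matrices with `2` on the diagonal and `-B`, `-B*` beside it
are positive. Their Schur complements `X₀ = 2`, `Xₖ₊₁ = 2 - B* Xₖ⁻¹ B` therefore stay bounded below.
Since `2 - x ≤ min(1/x, 2) ≤ 1/x` for `0 < x ≤ 2`, the operators `Nₖ = min(Xₖ⁻¹, 2)` satisfy `B* Nₖ
B ≤ Nₖ₊₁`. Averaging many of them gives one metric for `A`, at the price of an arbitrarily small
loss in the contraction constant, so no limit of the `Xₖ` is needed.

The von Neumann inequality follows from an operator Poisson formula on a circle whose kernel is
positive exactly because `A` contracts `N`.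

For the lower bound, `r(z) = z` and the `2 × 2` nilpotents of norm `2t`, `t < 1`, suffice: their
numerical ranges lie in the closed disk of radius `t`. -/

noncomputable section

namespace NumRange

/-! ### Positivity of block Toeplitz forms. -/

section

variable {H : Type*} [NormedAddCommGroup H] [InnerProductSpace ℂ H]

/-- Orthogonality relations for the discrete Fourier transform of a finite sequence of vectors. -/
lemma sum_pow_mul_inner_rootsOfUnity {M K s : ℕ} (hM : K + s ≤ M) {ω : ℂ}
    (hω : IsPrimitiveRoot ω M) (T : H →L[ℂ] H) (v : ℕ → H) :
    ∑ k ∈ Finset.range M, (ω ^ k) ^ s *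
        inner ℂ (∑ i ∈ Finset.range K, (ω ^ k) ^ i • v i)
          (T (∑ j ∈ Finset.range K, (ω ^ k) ^ j • v j)) =
      M * ∑ i ∈ Finset.range K, ∑ j ∈ Finset.range K,
        if i = j + s then inner ℂ (v i) (T (v j)) else 0 := by
  rcases Nat.eq_zero_or_pos M with rfl | hMpos
  · simp
  have hω0 : ω ≠ 0 := hω.ne_zero hMpos.ne'
  have hconj : (starRingEnd ℂ) ω = ω⁻¹ := by
    rw [Complex.inv_eq_conj]
    exact Complex.norm_eq_one_of_pow_eq_one hω.pow_eq_one hMpos.ne'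
  have key : ∀ i ∈ Finset.range K, ∀ j ∈ Finset.range K,
      ∑ k ∈ Finset.range M, (ω ^ k) ^ s * ((starRingEnd ℂ) ((ω ^ k) ^ i) * (ω ^ k) ^ j) =
        if i = j + s then (M : ℂ) else 0 := by
    intro i hi j hj
    have h1 : ∀ k : ℕ, (ω ^ k) ^ s * ((starRingEnd ℂ) ((ω ^ k) ^ i) * (ω ^ k) ^ j) =
        (ω ^ ((j : ℤ) + s - i)) ^ k := by
      intro k
      simp only [map_pow, hconj]
      simp only [← zpow_natCast, ← zpow_mul, inv_zpow', ← zpow_add₀ hω0]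
      congr 1
      ring
    simp only [h1]
    split_ifs with h
    · have : (j : ℤ) + s - i = 0 := by rw [h]; push_cast; ring
      simp [this]
    -- The exponent is nonzero and, since `K + s ≤ M`, smaller than `M` in absolute value; the
    -- geometric sum of a nontrivial root of unity vanishes.
    · have hne : ω ^ ((j : ℤ) + s - i) ≠ 1 := by
        intro h2
        rw [hω.zpow_eq_one_iff_dvd] at h2
        rw [Finset.mem_range] at hi hj
        have := Int.eq_zero_of_abs_lt_dvd h2 (by rw [abs_lt]; constructor <;> omega)
        omega
      have h3 := mul_geom_sum (ω ^ ((j : ℤ) + s - i)) M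
      have h4 : (ω ^ ((j : ℤ) + s - i)) ^ M = 1 := by
        rw [← zpow_natCast, ← zpow_mul, mul_comm, zpow_mul, zpow_natCast, hω.pow_eq_one, one_zpow]
      rw [h4, sub_self] at h3
      exact (mul_eq_zero.mp h3).resolve_left (sub_ne_zero.mpr hne)
  simp only [map_sum, map_smul, sum_inner, inner_sum, inner_smul_left, inner_smul_right,
    Finset.mul_sum]
  rw [Finset.sum_comm]
  conv_rhs => rw [Finset.sum_comm]
  refine Finset.sum_congr rfl fun j hj => ?_
  rw [Finset.sum_comm]
  refine Finset.sum_congr rfl fun i hi => ?_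
  have := key i hi j hj
  calc _ = (∑ k ∈ Finset.range M, (ω ^ k) ^ s * ((starRingEnd ℂ) ((ω ^ k) ^ i) * (ω ^ k) ^ j)) *
        inner ℂ (v i) (T (v j)) := by
        rw [Finset.sum_mul]
        exact Finset.sum_congr rfl fun k _ => by ring
    _ = _ := by rw [this]; split_ifs <;> simp

/-- A bound on the numerical radius of `B` makes the tridiagonal block Toeplitz form of `B`
positive. -/
lemma sum_re_inner_succ_le {B : H →L[ℂ] H} {ρ : ℝ}
    (hB : ∀ x, ‖inner ℂ x (B x)‖ ≤ ρ * ‖x‖ ^ 2) (N : ℕ) (v : ℕ → H) :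
    ∑ i ∈ Finset.range N, (inner ℂ (v (i + 1)) (B (v i))).re ≤
      ρ * ∑ i ∈ Finset.range (N + 1), ‖v i‖ ^ 2 := by
  -- There are `N + 1` vectors and a shift by one, so `N + 2` roots of unity avoid wrap-around.
  set M := N + 2 with hM
  have hω := Complex.isPrimitiveRoot_exp M (by omega)
  set ω := Complex.exp (2 * Real.pi * Complex.I / M)
  have h0 := sum_pow_mul_inner_rootsOfUnity (K := N + 1) (s := 0) (by omega) hω
    (ContinuousLinearMap.id ℂ H) v
  have h1 := sum_pow_mul_inner_rootsOfUnity (K := N + 1) (s := 1) (by omega) hω B v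
  set x : ℕ → H := fun k => ∑ i ∈ Finset.range (N + 1), (ω ^ k) ^ i • v i with hx
  have e0 : ∑ k ∈ Finset.range M, ‖x k‖ ^ 2 =
      M * ∑ i ∈ Finset.range (N + 1), ‖v i‖ ^ 2 := by
    have : ((∑ k ∈ Finset.range M, ‖x k‖ ^ 2 : ℝ) : ℂ) =
        ((M * ∑ i ∈ Finset.range (N + 1), ‖v i‖ ^ 2 : ℝ) : ℂ) := by
      push_cast
      simp only [pow_zero, one_mul, ContinuousLinearMap.id_apply, add_zero] at h0
      calc _ = _ := Finset.sum_congr rfl fun k _ => (inner_self_eq_norm_sq_to_K (𝕜 := ℂ) (x k)).symm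
        _ = _ := h0
        _ = _ := by
          congr 1
          refine Finset.sum_congr rfl fun i hi => ?_
          rw [Finset.sum_ite_eq, if_pos hi]
          exact inner_self_eq_norm_sq_to_K (𝕜 := ℂ) (v i)
    exact_mod_cast this
  have e1 : ∑ i ∈ Finset.range (N + 1), ∑ j ∈ Finset.range (N + 1),
      (if i = j + 1 then inner ℂ (v i) (B (v j)) else 0) =
      ∑ j ∈ Finset.range N, inner ℂ (v (j + 1)) (B (v j)) := by
    rw [Finset.sum_comm, Finset.sum_range_succ]
    have : ∑ i ∈ Finset.range (N + 1),
        (if i = N + 1 then inner ℂ (v i) (B (v N)) else (0 : ℂ)) = 0 := by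
      refine Finset.sum_eq_zero fun i hi => if_neg ?_
      rw [Finset.mem_range] at hi
      omega
    rw [this, add_zero]
    refine Finset.sum_congr rfl fun j hj => ?_
    rw [Finset.sum_ite_eq', if_pos]
    simpa using hj
  rw [e1] at h1
  have hωn : ‖ω‖ = 1 := Complex.norm_eq_one_of_pow_eq_one hω.pow_eq_one (by omega)
  have hb : ‖(M : ℂ) * ∑ j ∈ Finset.range N, inner ℂ (v (j + 1)) (B (v j))‖ ≤
      ρ * (M * ∑ i ∈ Finset.range (N + 1), ‖v i‖ ^ 2) := by
    rw [← h1, ← e0, Finset.mul_sum]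
    refine (norm_sum_le _ _).trans (Finset.sum_le_sum fun k _ => ?_)
    rw [norm_mul, norm_pow, norm_pow, hωn, one_pow, one_pow, one_mul]
    exact hB (x k)
  rw [norm_mul, Complex.norm_natCast] at hb
  have hMpos : (0 : ℝ) < M := by positivity
  have := (Complex.re_le_norm (∑ j ∈ Finset.range N, inner ℂ (v (j + 1)) (B (v j))))
  rw [Complex.re_sum] at this
  refine this.trans (le_of_mul_le_mul_left ?_ hMpos)
  linarith

end

/-! ### Schur complements and their truncated inverses. -/

section

variable {H : Type*} [NormedAddCommGroup H] [InnerProductSpace ℂ H]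

lemma two_apply_eq_smul (h : H) : (2 : H →L[ℂ] H) h = (2 : ℂ) • h := by
  rw [← one_add_one_eq_two, add_apply, two_smul]
  rfl

variable [CompleteSpace H]

/-- The Schur complements of the block tridiagonal Toeplitz matrices with `2` on the diagonal and
`-B`, `-B*` next to it. -/
def schurSeq (B : H →L[ℂ] H) : ℕ → H →L[ℂ] H
  | 0 => 2
  | k + 1 => 2 - star B * Ring.inverse (schurSeq B k) * B

lemma isUnit_of_le_re_inner {T : H →L[ℂ] H} {δ : ℝ} (hδ : 0 < δ)
    (h : ∀ x, δ * ‖x‖ ^ 2 ≤ (inner ℂ x (T x)).re) : IsUnit T := by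
  refine T.isUnit_of_forall_le_norm_inner_map (c := ⟨δ, hδ.le⟩) hδ fun x => ?_
  rw [norm_inner_symm, mul_comm]
  exact (h x).trans (Complex.re_le_norm _)

lemma schurSeq_isSelfAdjoint (B : H →L[ℂ] H) (n : ℕ) : IsSelfAdjoint (schurSeq B n) := by
  induction n with
  | zero => simp [schurSeq]
  | succ n ih =>
    rw [isSelfAdjoint_iff] at ih ⊢
    simp only [schurSeq, star_sub, star_mul, star_star, ← Ring.inverse_star, ih, mul_assoc]
    simp

lemma re_two_mul_sq (a : ℝ) : ((2 : ℂ) * (a : ℂ) ^ 2).re = 2 * a ^ 2 := by norm_cast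

/-- The Schur complement is the minimum of the block Toeplitz form. -/
lemma schurSeq_bound {B : H →L[ℂ] H} {ρ : ℝ} (hρ : ρ < 1)
    (hB : ∀ x, ‖inner ℂ x (B x)‖ ≤ ρ * ‖x‖ ^ 2) (n : ℕ) :
    ∀ h, 2 * (1 - ρ) * ‖h‖ ^ 2 ≤ (inner ℂ h (schurSeq B n h)).re := by
  -- The induction carries the vectors `v` realizing the Schur complement as a value of the Toeplitz
  -- form. The bound then holds at each level, and it supplies the invertibility needed at the next.
  have key : ∀ n h, (∃ v : ℕ → H, v 0 = h ∧ (inner ℂ h (schurSeq B n h)).re =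
      2 * ∑ i ∈ Finset.range (n + 1), ‖v i‖ ^ 2 -
        2 * ∑ i ∈ Finset.range n, (inner ℂ (v (i + 1)) (B (v i))).re) →
      2 * (1 - ρ) * ‖h‖ ^ 2 ≤ (inner ℂ h (schurSeq B n h)).re := by
    rintro n h ⟨v, rfl, hv⟩
    have h1 := sum_re_inner_succ_le hB n v
    have h2 : ‖v 0‖ ^ 2 ≤ ∑ i ∈ Finset.range (n + 1), ‖v i‖ ^ 2 :=
      Finset.single_le_sum (f := fun i => ‖v i‖ ^ 2) (fun i _ => by positivity) (by simp)
    rw [hv]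
    nlinarith
  refine fun h => key n h ?_
  induction n generalizing h with
  | zero =>
    refine ⟨fun _ => h, rfl, ?_⟩
    have : (schurSeq B 0) h = (2 : ℂ) • h := by
      rw [schurSeq, two_apply_eq_smul]
    rw [this, inner_smul_right, inner_self_eq_norm_sq_to_K]
    erw [re_two_mul_sq]
    simp
  | succ n ih =>
    have hu : IsUnit (schurSeq B n) :=
      isUnit_of_le_re_inner (δ := 2 * (1 - ρ)) (by linarith) fun h => key n h (ih h)
    set w := Ring.inverse (schurSeq B n) (B h) with hw
    have hXw : schurSeq B n w = B h := by
      exact congrArg (fun T : H →L[ℂ] H => T (B h)) (Ring.mul_inverse_cancel _ hu)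
    obtain ⟨v, hv0, hv⟩ := ih w
    -- With first vector `h`, the next one `w = Xₙ⁻¹ B h` minimizes `⟨Xₙ w, w⟩ - 2 Re ⟨B h, w⟩`.
    refine ⟨fun i => Nat.casesOn i h v, rfl, ?_⟩
    have e1 : schurSeq B (n + 1) h = (2 : ℂ) • h - star B w := by
      rw [schurSeq, sub_apply, two_apply_eq_smul]
      rfl
    rw [hXw] at hv
    rw [e1, inner_sub_right, inner_smul_right, inner_self_eq_norm_sq_to_K,
      ContinuousLinearMap.star_eq_adjoint, ContinuousLinearMap.adjoint_inner_right]
    simp only [Finset.sum_range_succ', hv0] at hv ⊢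
    have e2 : (inner ℂ (B h) w).re = (inner ℂ w (B h)).re := inner_re_symm (𝕜 := ℂ) _ _
    rw [Complex.sub_re, e2]
    erw [re_two_mul_sq]
    change 2 * ‖h‖ ^ 2 - _ = 2 * (_ + ‖h‖ ^ 2) - 2 * (_ + (inner ℂ w (B h)).re)
    linarith

lemma le_iff_re_inner {S T : H →L[ℂ] H} (hS : IsSelfAdjoint S) (hT : IsSelfAdjoint T) :
    S ≤ T ↔ ∀ x, (inner ℂ x (S x)).re ≤ (inner ℂ x (T x)).re := by
  rw [← sub_nonneg, ContinuousLinearMap.nonneg_iff_isPositive,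
    ContinuousLinearMap.isPositive_def', and_iff_right (hT.sub hS)]
  refine forall_congr' fun x => ?_
  rw [ContinuousLinearMap.reApplyInnerSelf_apply, inner_re_symm (𝕜 := ℂ),
    sub_apply, inner_sub_right, map_sub, sub_nonneg]
  rfl

lemma schurSeq_le_two {B : H →L[ℂ] H} {n : ℕ} (h : 0 ≤ Ring.inverse (schurSeq B n)) :
    schurSeq B (n + 1) ≤ 2 := by
  rw [schurSeq, sub_le_self_iff]
  exact star_left_conjugate_nonneg h B

/-- Functional calculus applied to `min(1/x, 2)`. The truncation at 2 makes the upper bound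
independent of `δ`, and the lower bound `2 - x` survives it because `x > 0`. -/
lemma exists_mem_Icc_schur {X : H →L[ℂ] H} {δ : ℝ} (hδ : 0 < δ)
    (hl : algebraMap ℝ _ δ ≤ X) (hu : X ≤ algebraMap ℝ _ 2) :
    0 ≤ Ring.inverse X ∧ ∃ N, IsSelfAdjoint N ∧ 2 - X ≤ N ∧ N ≤ Ring.inverse X ∧
      algebraMap ℝ _ (1 / 2) ≤ N ∧ N ≤ algebraMap ℝ _ 2 := by
  have hX : IsSelfAdjoint X := by
    have := (sub_nonneg.mpr hl).isSelfAdjoint.add (IsSelfAdjoint.algebraMap (H →L[ℂ] H) (IsSelfAdjoint.all δ))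
    simpa using this
  have hs1 : ∀ x ∈ spectrum ℝ X, δ ≤ x := (algebraMap_le_iff_le_spectrum).mp hl
  have hs2 : ∀ x ∈ spectrum ℝ X, x ≤ 2 := (le_algebraMap_iff_spectrum_le).mp hu
  have hc : ContinuousOn (fun x : ℝ => x⁻¹) (spectrum ℝ X) :=
    continuousOn_inv₀.mono fun x hx => (hδ.trans_le (hs1 x hx)).ne'
  have hinv : Ring.inverse X = cfc (fun x : ℝ => x⁻¹) X := by
    have h1 : X * cfc (fun x : ℝ => x⁻¹) X = 1 := by
      conv_lhs => enter [1]; rw [← cfc_id ℝ X]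
      rw [← cfc_mul id _ X, ← cfc_one ℝ X]
      exact cfc_congr fun x hx => mul_inv_cancel₀ (hδ.trans_le (hs1 x hx)).ne'
    have h2 : cfc (fun x : ℝ => x⁻¹) X * X = 1 := by
      conv_lhs => enter [2]; rw [← cfc_id ℝ X]
      rw [← cfc_mul _ id X, ← cfc_one ℝ X]
      exact cfc_congr fun x hx => inv_mul_cancel₀ (hδ.trans_le (hs1 x hx)).ne'
    exact Ring.inverse_unit (⟨X, _, h1, h2⟩ : (H →L[ℂ] H)ˣ)
  have hc2 : ContinuousOn (fun x : ℝ => min x⁻¹ 2) (spectrum ℝ X) := hc.inf continuousOn_const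
  have h2X : 2 - X = cfc (fun x : ℝ => 2 - x) X := by
    rw [cfc_sub (fun _ : ℝ => (2 : ℝ)) (fun x : ℝ => x) X, cfc_const (2 : ℝ) X, cfc_id' ℝ X, map_ofNat]
  refine ⟨?_, cfc (fun x : ℝ => min x⁻¹ 2) X, cfc_predicate _ _, ?_, ?_, ?_, ?_⟩
  · rw [hinv]
    exact cfc_nonneg fun x hx => (inv_pos.mpr (hδ.trans_le (hs1 x hx))).le
  · rw [h2X]
    refine cfc_mono (f := fun x : ℝ => 2 - x) (g := fun x : ℝ => min x⁻¹ 2)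
      (fun x hx => ?_) (by fun_prop) hc2
    have hx0 := hδ.trans_le (hs1 x hx)
    refine le_min ?_ (by linarith)
    rw [inv_eq_one_div, le_div_iff₀ hx0]
    nlinarith [sq_nonneg (x - 1)]
  · rw [hinv]
    exact cfc_mono (f := fun x : ℝ => min x⁻¹ 2) (g := fun x : ℝ => x⁻¹)
      (fun x _ => min_le_left _ _) hc2 hc
  · refine algebraMap_le_cfc (fun x : ℝ => min x⁻¹ 2) _ X (hf := hc2) fun x hx => ?_
    have hx0 := hδ.trans_le (hs1 x hx)
    refine le_min ?_ (by norm_num)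
    rw [inv_eq_one_div]
    exact one_div_le_one_div_of_le hx0 (hs2 x hx)
  · exact cfc_le_algebraMap (fun x : ℝ => min x⁻¹ 2) _ X (hf := hc2) fun x hx => min_le_right _ _

end

/-! ### The contracting metric. -/

section

variable {H : Type*} [NormedAddCommGroup H] [InnerProductSpace ℂ H]

lemma re_inner_algebraMap (c : ℝ) (x : H) :
    (inner ℂ x (algebraMap ℝ (H →L[ℂ] H) c x)).re = c * ‖x‖ ^ 2 := by
  rw [Algebra.algebraMap_eq_smul_one, smul_apply, one_apply_eq_self, ← Complex.coe_smul,
    inner_smul_right, Complex.re_ofReal_mul]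
  congr 1
  exact inner_self_eq_norm_sq (𝕜 := ℂ) x

variable [CompleteSpace H]

lemma isSelfAdjoint_algebraMap_real (c : ℝ) :
    IsSelfAdjoint (algebraMap ℝ (H →L[ℂ] H) c) :=
  IsSelfAdjoint.algebraMap _ (IsSelfAdjoint.all c)

/-- A sequence of equivalent metrics, each contracted by `B` into the next one. -/
lemma exists_metric_seq {B : H →L[ℂ] H} {ρ : ℝ} (hρ : ρ < 1)
    (hB : ∀ x, ‖inner ℂ x (B x)‖ ≤ ρ * ‖x‖ ^ 2) :
    ∃ N : ℕ → H →L[ℂ] H, ∀ k, IsSelfAdjoint (N k) ∧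
      (∀ x, 1 / 2 * ‖x‖ ^ 2 ≤ (inner ℂ x (N k x)).re) ∧
      (∀ x, (inner ℂ x (N k x)).re ≤ 2 * ‖x‖ ^ 2) ∧
      ∀ x, (inner ℂ (B x) (N k (B x))).re ≤ (inner ℂ x (N (k + 1) x)).re := by
  have hδ : 0 < 2 * (1 - ρ) := by linarith
  have hl : ∀ k, algebraMap ℝ _ (2 * (1 - ρ)) ≤ schurSeq B k := fun k => by
    rw [le_iff_re_inner (isSelfAdjoint_algebraMap_real _) (schurSeq_isSelfAdjoint B k)]
    intro x
    rw [re_inner_algebraMap]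
    exact schurSeq_bound hρ hB k x
  have hu : ∀ k, schurSeq B k ≤ algebraMap ℝ _ 2 := fun k => by
    induction k with
    | zero => rw [schurSeq, map_ofNat]
    | succ k ih =>
      rw [map_ofNat]
      exact schurSeq_le_two (exists_mem_Icc_schur hδ (hl k) ih).1
  choose h0 N hN1 hN2 hN3 hN4 hN5 using fun k => exists_mem_Icc_schur hδ (hl k) (hu k)
  refine ⟨N, fun k => ⟨hN1 k, fun x => ?_, fun x => ?_, fun x => ?_⟩⟩
  · rw [← re_inner_algebraMap]
    exact (le_iff_re_inner (isSelfAdjoint_algebraMap_real _) (hN1 k)).mp (hN4 k) x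
  · rw [← re_inner_algebraMap]
    exact (le_iff_re_inner (hN1 k) (isSelfAdjoint_algebraMap_real _)).mp (hN5 k) x
  · have h1 := star_left_conjugate_le_conjugate (hN3 k) B
    have h2 : star B * N k * B ≤ N (k + 1) := by
      refine h1.trans (le_trans (le_of_eq ?_) (hN2 (k + 1)))
      rw [schurSeq, sub_sub_cancel]
    have h3 := (le_iff_re_inner ((hN1 k).conjugate' B) (hN1 (k + 1))).mp h2 x
    rw [← ContinuousLinearMap.adjoint_inner_right]
    exact h3

/-- An operator with numerical radius less than one is a strict contraction for an equivalent
Hilbert norm whose distortion is at most two. -/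
lemma exists_metric {A : H →L[ℂ] H} {ρ : ℝ} (hρ0 : 0 ≤ ρ) (hρ : ρ < 1)
    (hA : ∀ x, ‖inner ℂ x (A x)‖ ≤ ρ * ‖x‖ ^ 2) :
    ∃ (N : H →L[ℂ] H) (s : ℝ), ρ < s ∧ s < 1 ∧ IsSelfAdjoint N ∧
      (∀ x, 1 / 2 * ‖x‖ ^ 2 ≤ (inner ℂ x (N x)).re) ∧
      (∀ x, (inner ℂ x (N x)).re ≤ 2 * ‖x‖ ^ 2) ∧
      ∀ x, (inner ℂ (A x) (N (A x))).re ≤ s ^ 2 * (inner ℂ x (N x)).re := by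
  -- `B = A / t` still has numerical radius at most `ρ / t < 1`; the gap between `t` and `s` pays
  -- for the averaging error.
  obtain ⟨t, ht0, ht1⟩ := exists_between hρ
  obtain ⟨s, hs0, hs1⟩ := exists_between ht1
  have htpos : 0 < t := hρ0.trans_lt ht0
  set B : H →L[ℂ] H := ((t⁻¹ : ℝ) : ℂ) • A with hBdef
  have hAB : ∀ x, A x = (t : ℂ) • B x := fun x => by
    rw [hBdef, smul_apply, smul_smul, ← Complex.ofReal_mul, mul_inv_cancel₀ htpos.ne']
    simp
  have hB : ∀ x, ‖inner ℂ x (B x)‖ ≤ (ρ / t) * ‖x‖ ^ 2 := fun x => by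
    rw [hBdef, smul_apply, inner_smul_right, norm_mul, Complex.norm_real, Real.norm_eq_abs,
      abs_of_pos (inv_pos.mpr htpos), div_eq_inv_mul, mul_assoc]
    exact mul_le_mul_of_nonneg_left (hA x) (inv_pos.mpr htpos).le
  obtain ⟨N, hN⟩ := exists_metric_seq ((div_lt_one htpos).mpr ht0) hB
  -- The boundary term of the average is at most `2 t² ‖x‖² / n`, that is `4 t² / n` times the lower
  -- bound `½‖x‖²` of the metric.
  obtain ⟨n, hn⟩ := exists_nat_gt (4 * t ^ 2 / (s ^ 2 - t ^ 2))
  have hst : 0 < s ^ 2 - t ^ 2 := by nlinarith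
  have hnpos : (0 : ℝ) < n := lt_of_le_of_lt (by positivity) hn
  have hn' : 4 * t ^ 2 / n ≤ s ^ 2 - t ^ 2 := by
    rw [div_lt_iff₀ hst] at hn
    rw [div_le_iff₀ hnpos]
    linarith
  have hq : ∀ x, (inner ℂ x ((((n : ℝ)⁻¹ : ℝ) • ∑ k ∈ Finset.range n, N k) x)).re =
      (n : ℝ)⁻¹ * ∑ k ∈ Finset.range n, (inner ℂ x (N k x)).re := fun x => by
    rw [smul_apply, ← Complex.coe_smul, inner_smul_right, Complex.re_ofReal_mul,
      sum_apply, inner_sum, Complex.re_sum]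
  have hlow : ∀ x, 1 / 2 * ‖x‖ ^ 2 ≤
      (n : ℝ)⁻¹ * ∑ k ∈ Finset.range n, (inner ℂ x (N k x)).re := fun x => by
    rw [← div_eq_inv_mul, le_div_iff₀ hnpos]
    have := Finset.sum_le_sum fun k (_ : k ∈ Finset.range n) => (hN k).2.1 x
    simp only [Finset.sum_const, Finset.card_range, nsmul_eq_mul] at this
    linarith
  refine ⟨(n : ℝ)⁻¹ • ∑ k ∈ Finset.range n, N k, s, ht0.trans hs0, hs1, ?_, fun x => ?_,
    fun x => ?_, fun x => ?_⟩
  · exact (IsSelfAdjoint.all _).smul (isSelfAdjoint_sum _ fun k _ => (hN k).1)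
  · rw [hq]
    exact hlow x
  · rw [hq, ← div_eq_inv_mul, div_le_iff₀ hnpos]
    have := Finset.sum_le_sum fun k (_ : k ∈ Finset.range n) => (hN k).2.2.1 x
    simp only [Finset.sum_const, Finset.card_range, nsmul_eq_mul] at this
    linarith
  · rw [hq, hq]
    have e1 : ∀ k, (inner ℂ (A x) (N k (A x))).re = t ^ 2 * (inner ℂ (B x) (N k (B x))).re :=
      fun k => by
        rw [hAB, map_smul, inner_smul_left, inner_smul_right, ← mul_assoc, Complex.conj_ofReal,
          ← Complex.ofReal_mul, Complex.re_ofReal_mul, sq]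
    simp only [e1, ← Finset.mul_sum]
    have h1 := Finset.sum_le_sum fun k (_ : k ∈ Finset.range n) => (hN k).2.2.2 x
    -- Shifting the index changes the sum only by the last term minus the first: at most `2‖x‖²`, as
    -- `N 0` is positive.
    have h2 := Finset.sum_range_succ (fun k => (inner ℂ x (N k x)).re) n
    rw [Finset.sum_range_succ'] at h2
    have h3 := (hN n).2.2.1 x
    have h4 := (hN 0).2.1 x
    set S := ∑ k ∈ Finset.range n, (inner ℂ x (N k x)).re
    have h5 := hlow x
    have h6 : 0 ≤ ‖x‖ ^ 2 := by positivity
    have h7 : ∑ k ∈ Finset.range n, (inner ℂ (B x) (N k (B x))).re ≤ S + 2 * ‖x‖ ^ 2 := by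
      linarith
    calc (n : ℝ)⁻¹ * (t ^ 2 * ∑ k ∈ Finset.range n, (inner ℂ (B x) (N k (B x))).re)
        ≤ (n : ℝ)⁻¹ * (t ^ 2 * (S + 2 * ‖x‖ ^ 2)) := by gcongr
      _ = t ^ 2 * ((n : ℝ)⁻¹ * S) + 4 * t ^ 2 / n * (1 / 2 * ‖x‖ ^ 2) := by ring
      _ ≤ t ^ 2 * ((n : ℝ)⁻¹ * S) + (s ^ 2 - t ^ 2) * ((n : ℝ)⁻¹ * S) := by gcongr
      _ = s ^ 2 * ((n : ℝ)⁻¹ * S) := by ring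

end

/-! ### Resolvents and difference quotients. -/

section

variable {H : Type*} [NormedAddCommGroup H] [InnerProductSpace ℂ H] [CompleteSpace H]

/-- The form of `z - A` is coercive: its modulus at `x` is at least `(‖z‖ - ρ)‖x‖²`. -/
lemma isUnit_algebraMap_sub {A : H →L[ℂ] H} {ρ : ℝ}
    (hA : ∀ x, ‖inner ℂ x (A x)‖ ≤ ρ * ‖x‖ ^ 2) {z : ℂ} (hz : ρ < ‖z‖) :
    IsUnit (algebraMap ℂ (H →L[ℂ] H) z - A) := by
  refine ContinuousLinearMap.isUnit_of_forall_le_norm_inner_map _ (c := ⟨‖z‖ - ρ, by linarith⟩)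
    (sub_pos.mpr hz) fun x => ?_
  change ‖x‖ ^ 2 * (‖z‖ - ρ) ≤ _
  have h1 : inner ℂ x ((algebraMap ℂ (H →L[ℂ] H) z - A) x) =
      z * (‖x‖ : ℂ) ^ 2 - inner ℂ x (A x) := by
    rw [sub_apply, inner_sub_right, Algebra.algebraMap_eq_smul_one, smul_apply,
      one_apply_eq_self, inner_smul_right, inner_self_eq_norm_sq_to_K]
    rfl
  have h2 := norm_sub_norm_le (z * (‖x‖ : ℂ) ^ 2) (inner ℂ x (A x))
  have h3 : ‖z * (‖x‖ : ℂ) ^ 2‖ = ‖z‖ * ‖x‖ ^ 2 := by simp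
  rw [norm_inner_symm, h1]
  have := hA x
  rw [h3] at h2
  linarith

/-- By spectral mapping, failure would give a zero of `q` in the spectrum of `A`, which lies inside
the open unit disk. -/
lemma isUnit_aeval_of_forall_eval_ne_zero {A : H →L[ℂ] H} {ρ : ℝ} (hρ : ρ < 1)
    (hA : ∀ x, ‖inner ℂ x (A x)‖ ≤ ρ * ‖x‖ ^ 2) {q : Polynomial ℂ}
    (hq : ∀ z ∈ Metric.ball (0 : ℂ) 1, q.eval z ≠ 0) : IsUnit (Polynomial.aeval A q) := by
  nontriviality (H →L[ℂ] H)
  by_contra h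
  rw [← spectrum.zero_mem_iff ℂ, spectrum.map_polynomial_aeval] at h
  obtain ⟨z, hz, hz0⟩ := h
  refine hq z ?_ hz0
  rw [mem_ball_zero_iff]
  by_contra hz1
  exact hz (isUnit_algebraMap_sub hA (by linarith))

lemma norm_inner_star_apply_le {A : H →L[ℂ] H} {ρ : ℝ}
    (hA : ∀ x, ‖inner ℂ x (A x)‖ ≤ ρ * ‖x‖ ^ 2) (x : H) :
    ‖inner ℂ x (star A x)‖ ≤ ρ * ‖x‖ ^ 2 := by
  rw [ContinuousLinearMap.star_eq_adjoint, ContinuousLinearMap.adjoint_inner_right,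
    norm_inner_symm]
  exact hA x

/-- The difference quotient of a polynomial at an operator. -/
lemma exists_differentiable_eval_sub_aeval (A : H →L[ℂ] H) (p : Polynomial ℂ) :
    ∃ h : ℂ → H →L[ℂ] H, Differentiable ℂ h ∧ ∀ z,
      algebraMap ℂ _ (p.eval z) - Polynomial.aeval A p = (algebraMap ℂ _ z - A) * h z := by
  induction p using Polynomial.induction_on' with
  | add p q hp hq =>
    obtain ⟨f, hf, hf'⟩ := hp
    obtain ⟨g, hg, hg'⟩ := hq
    refine ⟨fun z => f z + g z, hf.add hg, fun z => ?_⟩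
    rw [mul_add, ← hf', ← hg', Polynomial.eval_add, map_add, map_add]
    abel
  | monomial n a =>
    refine ⟨fun z => a • ∑ i ∈ Finset.range n, (z ^ i) • A ^ (n - 1 - i), by fun_prop,
      fun z => ?_⟩
    have h := Commute.mul_geom_sum₂ (Algebra.commutes z A : Commute (algebraMap ℂ (H →L[ℂ] H) z) A) n
    simp only [← map_pow, ← Algebra.smul_def] at h
    rw [mul_smul_comm, h, Polynomial.eval_monomial, Polynomial.aeval_monomial, map_mul, smul_sub,
      Algebra.smul_def, Algebra.smul_def, map_pow]

/-- The difference quotient of a rational function at an operator. -/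
lemma exists_differentiableOn_evalAt_sub_evalOp {A : H →L[ℂ] H} {r : RatFunc ℂ}
    (hr : NoPoleOn r (Metric.ball 0 1)) (hu : IsUnit (Polynomial.aeval A r.denom)) :
    ∃ h : ℂ → H →L[ℂ] H, DifferentiableOn ℂ h (Metric.ball 0 1) ∧ ∀ z ∈ Metric.ball (0 : ℂ) 1,
      algebraMap ℂ _ (evalAt r z) - evalOp r A = (algebraMap ℂ _ z - A) * h z := by
  obtain ⟨f, hf, hf'⟩ := exists_differentiable_eval_sub_aeval A r.num
  obtain ⟨g, hg, hg'⟩ := exists_differentiable_eval_sub_aeval A r.denom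
  set p := r.num
  set q := r.denom
  -- A quotient rule: `z - A` times the inner difference is `p(z) q(A) - q(z) p(A)`.
  refine ⟨fun z => (q.eval z)⁻¹ • ((f z * Polynomial.aeval A q - g z * Polynomial.aeval A p) *
    Ring.inverse (Polynomial.aeval A q)), ?_, fun z hz => ?_⟩
  · refine DifferentiableOn.smul (q.differentiable.differentiableOn.inv hr) ?_
    exact (((hf.mul_const _).sub (hg.mul_const _)).mul_const _).differentiableOn
  · have hqz : q.eval z ≠ 0 := hr z hz
    have hev : evalAt r z = (q.eval z)⁻¹ * p.eval z := by
      rw [evalAt, RatFunc.eval, Polynomial.eval₂_id, Polynomial.eval₂_id, div_eq_inv_mul]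
    have h1 : (algebraMap ℂ _ z - A) * (f z * Polynomial.aeval A q - g z * Polynomial.aeval A p) =
        (p.eval z) • Polynomial.aeval A q - (q.eval z) • Polynomial.aeval A p := by
      have hc : Polynomial.aeval A p * Polynomial.aeval A q =
          Polynomial.aeval A q * Polynomial.aeval A p := by
        rw [← map_mul, ← map_mul, mul_comm]
      rw [mul_sub, ← mul_assoc, ← mul_assoc, ← hf', ← hg', sub_mul, sub_mul, Algebra.smul_def,
        Algebra.smul_def, hc]
      abel
    rw [mul_smul_comm, ← mul_assoc, h1, sub_mul, smul_mul_assoc, smul_mul_assoc,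
      Ring.mul_inverse_cancel _ hu, smul_sub, smul_smul, smul_smul, inv_mul_cancel₀ hqz, one_smul,
      hev, Algebra.algebraMap_eq_smul_one]
    rfl

lemma differentiableOn_evalAt {r : RatFunc ℂ} {s : Set ℂ} (hr : NoPoleOn r s) :
    DifferentiableOn ℂ (evalAt r) s := by
  have : evalAt r = fun z => r.num.eval z / r.denom.eval z := by
    ext z
    rw [evalAt, RatFunc.eval, Polynomial.eval₂_id, Polynomial.eval₂_id]
  rw [this]
  exact r.num.differentiable.differentiableOn.div r.denom.differentiable.differentiableOn hr

/-- The conjugate of `z (z - A)⁻¹` on the circle of radius `s`, extended analytically to the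
disk. -/
def conjResolvent (A : H →L[ℂ] H) (s : ℝ) (z : ℂ) : H →L[ℂ] H :=
  Ring.inverse (1 - (z / s ^ 2) • star A)

lemma conjResolvent_zero (A : H →L[ℂ] H) (s : ℝ) : conjResolvent A s 0 = 1 := by
  simp [conjResolvent]

/-- For `z ≠ 0`, factor out `z / s²`: what remains is `s² / z - A*`, where `‖s² / z‖ ≥ s > ρ` and
`A*` obeys the same numerical radius bound. -/
lemma isUnit_one_sub_smul_star {A : H →L[ℂ] H} {ρ s : ℝ} (hs : 0 < s) (hρs : ρ < s)
    (hA : ∀ x, ‖inner ℂ x (A x)‖ ≤ ρ * ‖x‖ ^ 2) {z : ℂ} (hz : ‖z‖ ≤ s) :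
    IsUnit (1 - (z / s ^ 2) • star A) := by
  rcases eq_or_ne z 0 with rfl | hz0
  · simp
  have hs' : (s : ℂ) ≠ 0 := by exact_mod_cast hs.ne'
  have h1 : ρ < ‖(s : ℂ) ^ 2 / z‖ := by
    rw [norm_div, norm_pow, Complex.norm_real, Real.norm_eq_abs, abs_of_pos hs,
      lt_div_iff₀ (norm_pos_iff.mpr hz0)]
    nlinarith [norm_pos_iff.mpr hz0]
  have h2 := isUnit_algebraMap_sub (norm_inner_star_apply_le hA) h1
  have h3 : z / s ^ 2 ≠ 0 := div_ne_zero hz0 (pow_ne_zero _ hs')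
  have h4 : (1 - (z / s ^ 2) • star A) =
      (z / s ^ 2) • (algebraMap ℂ (H →L[ℂ] H) ((s : ℂ) ^ 2 / z) - star A) := by
    rw [smul_sub, Algebra.algebraMap_eq_smul_one, smul_smul, div_mul_div_cancel₀,
      div_self hz0, one_smul]
    exact pow_ne_zero _ hs'
  rw [h4]
  exact h2.smul (Units.mk0 _ h3)

lemma differentiableOn_conjResolvent {A : H →L[ℂ] H} {ρ s : ℝ} (hs : 0 < s) (hρs : ρ < s)
    (hA : ∀ x, ‖inner ℂ x (A x)‖ ≤ ρ * ‖x‖ ^ 2) :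
    DifferentiableOn ℂ (conjResolvent A s) (Metric.closedBall 0 s) := by
  intro z hz
  rw [mem_closedBall_zero_iff] at hz
  have h1 : DifferentiableAt ℂ (fun z : ℂ => 1 - (z / s ^ 2) • star A) z := by fun_prop
  exact ((differentiableAt_inverse (𝕜 := ℂ) (isUnit_one_sub_smul_star hs hρs hA hz)).comp z
    h1).differentiableWithinAt

/-- On the circle `z / s²` is the inverse of the conjugate of `z`. -/
lemma conjResolvent_eq_star {A : H →L[ℂ] H} {ρ s : ℝ} (hs : 0 < s) (hρs : ρ < s)
    (hA : ∀ x, ‖inner ℂ x (A x)‖ ≤ ρ * ‖x‖ ^ 2) {z : ℂ} (hz : ‖z‖ = s) :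
    conjResolvent A s z = star (z • Ring.inverse (algebraMap ℂ (H →L[ℂ] H) z - A)) := by
  have hz0 : z ≠ 0 := norm_pos_iff.mp (hz ▸ hs)
  have h1 : (z / s ^ 2) = (star z)⁻¹ := by
    have : star z * z = (s : ℂ) ^ 2 := by rw [← hz]; exact Complex.conj_mul' z
    rw [← this]
    have : star z ≠ 0 := star_ne_zero.mpr hz0
    field_simp
  have h2 : (1 - (z / s ^ 2) • star A) = star (z⁻¹ • (algebraMap ℂ (H →L[ℂ] H) z - A)) := by
    rw [star_smul, star_sub, ← algebraMap_star_comm, smul_sub, Algebra.algebraMap_eq_smul_one,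
      smul_smul, h1, star_inv₀, inv_mul_cancel₀ (star_ne_zero.mpr hz0), one_smul]
  rw [conjResolvent, h2, Ring.inverse_star]
  congr 1
  have hu := isUnit_algebraMap_sub hA (z := z) (by linarith)
  have hu' : IsUnit (z⁻¹ • (algebraMap ℂ (H →L[ℂ] H) z - A)) :=
    hu.smul (Units.mk0 _ (inv_ne_zero hz0))
  rw [← Ring.inverse_mul_cancel_left _ (z • Ring.inverse _) hu', smul_mul_smul_comm,
    Ring.mul_inverse_cancel _ hu, inv_mul_cancel₀ hz0, one_smul, mul_one]

end

/-! ### Cauchy and Poisson formulas. -/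

section

variable {H : Type*} [NormedAddCommGroup H] [InnerProductSpace ℂ H] [CompleteSpace H]

open Real Metric

lemma differentiableOn_resolvent {A : H →L[ℂ] H} {ρ s : ℝ} (hρs : ρ < s)
    (hA : ∀ x, ‖inner ℂ x (A x)‖ ≤ ρ * ‖x‖ ^ 2) :
    DifferentiableOn ℂ (fun z : ℂ => z • Ring.inverse (algebraMap ℂ (H →L[ℂ] H) z - A))
      (sphere 0 s) := by
  intro z hz
  rw [mem_sphere_zero_iff_norm] at hz
  have h1 : DifferentiableAt ℂ (fun z : ℂ => algebraMap ℂ (H →L[ℂ] H) z - A) z := by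
    simp only [Algebra.algebraMap_eq_smul_one]
    fun_prop
  exact (differentiableAt_id.smul ((differentiableAt_inverse (𝕜 := ℂ)
    (isUnit_algebraMap_sub hA (by linarith))).comp z h1)).differentiableWithinAt

/-- The adjoint of the integrand extends analytically to the disk as `conjResolvent`, with value 1
at the centre, so the mean value property applies to it. -/
lemma circleAverage_resolvent {A : H →L[ℂ] H} {ρ s : ℝ} (hs : 0 < s) (hρs : ρ < s)
    (hA : ∀ x, ‖inner ℂ x (A x)‖ ≤ ρ * ‖x‖ ^ 2) :
    circleAverage (fun z : ℂ => z • Ring.inverse (algebraMap ℂ (H →L[ℂ] H) z - A)) 0 s = 1 := by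
  have hd := differentiableOn_conjResolvent hs hρs hA
  have h1 : circleAverage (conjResolvent A s) 0 s = 1 := by
    rw [← conjResolvent_zero A s]
    refine DiffContOnCl.circleAverage ?_
    rw [abs_of_pos hs]
    exact hd.diffContOnCl_ball subset_rfl
  have h2 : CircleIntegrable (conjResolvent A s) 0 s :=
    (hd.continuousOn.mono sphere_subset_closedBall).circleIntegrable hs.le
  have h3 := (starL' ℝ : (H →L[ℂ] H) ≃L[ℝ] (H →L[ℂ] H)).toContinuousLinearMap.circleAverage_comp_comm
    h2
  rw [h1] at h3
  have h4 : (starL' ℝ : (H →L[ℂ] H) ≃L[ℝ] (H →L[ℂ] H)).toContinuousLinearMap 1 = 1 := by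
    exact star_one (H →L[ℂ] H)
  rw [h4] at h3
  rw [← h3]
  refine circleAverage_congr_sphere fun z hz => ?_
  rw [mem_sphere_zero_iff_norm, abs_of_pos hs] at hz
  change _ = star (conjResolvent A s z)
  rw [conjResolvent_eq_star hs hρs hA hz, star_star]

/-- The Cauchy formula for a rational function of an operator. -/
lemma circleAverage_evalAt_smul_resolvent {A : H →L[ℂ] H} {ρ s : ℝ} (hs : 0 < s) (hρs : ρ < s)
    (hs1 : s < 1) (hA : ∀ x, ‖inner ℂ x (A x)‖ ≤ ρ * ‖x‖ ^ 2) {r : RatFunc ℂ}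
    (hr : NoPoleOn r (ball 0 1)) :
    circleAverage (fun z : ℂ =>
      evalAt r z • (z • Ring.inverse (algebraMap ℂ (H →L[ℂ] H) z - A))) 0 s = evalOp r A := by
  obtain ⟨h, hd, hh⟩ := exists_differentiableOn_evalAt_sub_evalOp hr
    (isUnit_aeval_of_forall_eval_ne_zero (hρs.trans hs1) hA hr)
  have hsub : closedBall (0 : ℂ) s ⊆ ball 0 1 := closedBall_subset_ball hs1
  have hd2 : DifferentiableOn ℂ (fun z => z • h z) (ball 0 1) := differentiableOn_id.smul hd
  -- On the circle the integrand is `z (z - A)⁻¹ r(A) + z h(z)`; the second term is analytic and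
  -- vanishes at the centre.
  have h1 : circleAverage (fun z => z • h z) 0 s = 0 := by
    have : circleAverage (fun z => z • h z) 0 s = (0 : ℂ) • h 0 := by
      refine DiffContOnCl.circleAverage ?_
      rw [abs_of_pos hs]
      exact hd2.diffContOnCl_ball hsub
    rw [this, zero_smul]
  have i1 : CircleIntegrable (fun z => z • h z) 0 s :=
    (hd2.continuousOn.mono (sphere_subset_closedBall.trans hsub)).circleIntegrable hs.le
  have c2 := (differentiableOn_resolvent hρs hA).continuousOn
  have i2 := c2.circleIntegrable hs.le
  have h2 := ((ContinuousLinearMap.mul ℝ (H →L[ℂ] H)).flip (evalOp r A)).circleAverage_comp_comm i2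
  rw [circleAverage_resolvent hs hρs hA] at h2
  have i3 : CircleIntegrable (((ContinuousLinearMap.mul ℝ (H →L[ℂ] H)).flip (evalOp r A)) ∘
      fun z : ℂ => z • Ring.inverse (algebraMap ℂ (H →L[ℂ] H) z - A)) 0 s :=
    (ContinuousOn.comp (ContinuousLinearMap.continuous _).continuousOn c2
      (Set.mapsTo_univ _ _)).circleIntegrable hs.le
  have h3 := circleAverage_add i3 i1
  rw [h1, h2, add_zero] at h3
  change _ = 1 * evalOp r A at h3
  rw [one_mul] at h3
  rw [← h3]
  refine circleAverage_congr_sphere fun z hz => ?_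
  rw [abs_of_pos hs] at hz
  have hz1 := hsub (sphere_subset_closedBall hz)
  rw [mem_sphere_zero_iff_norm] at hz
  have hu := isUnit_algebraMap_sub hA (z := z) (by linarith)
  change _ = (z • Ring.inverse (algebraMap ℂ (H →L[ℂ] H) z - A)) * evalOp r A + z • h z
  rw [← Ring.inverse_mul_cancel_left _ (h z) hu, ← hh z hz1, smul_mul_assoc, ← smul_add, mul_sub,
    add_sub_cancel, smul_comm, Algebra.algebraMap_eq_smul_one (evalAt r z), mul_smul_comm, mul_one]

/-- The Poisson kernel of `A` on the circle of radius `s` for the metric `N`. -/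
def poissonKernelOp (A N : H →L[ℂ] H) (s : ℝ) (z : ℂ) : H →L[ℂ] H :=
  N * (z • Ring.inverse (algebraMap ℂ (H →L[ℂ] H) z - A)) + (conjResolvent A s z * N - N)

lemma continuousOn_poissonKernelOp {A : H →L[ℂ] H} (N : H →L[ℂ] H) {ρ s : ℝ} (hs : 0 < s)
    (hρs : ρ < s) (hA : ∀ x, ‖inner ℂ x (A x)‖ ≤ ρ * ‖x‖ ^ 2) :
    ContinuousOn (poissonKernelOp A N s) (sphere 0 s) := by
  have c1 := (differentiableOn_resolvent hρs hA).continuousOn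
  have c2 := (differentiableOn_conjResolvent hs hρs hA).continuousOn.mono sphere_subset_closedBall
  exact (continuousOn_const.mul c1).add ((c2.mul continuousOn_const).sub continuousOn_const)

/-- The Poisson formula for a rational function of an operator. -/
lemma circleAverage_evalAt_smul_poissonKernelOp {A : H →L[ℂ] H} (N : H →L[ℂ] H) {ρ s : ℝ}
    (hs : 0 < s) (hρs : ρ < s)
    (hs1 : s < 1) (hA : ∀ x, ‖inner ℂ x (A x)‖ ≤ ρ * ‖x‖ ^ 2) {r : RatFunc ℂ}
    (hr : NoPoleOn r (ball 0 1)) :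
    circleAverage (fun z : ℂ => evalAt r z • poissonKernelOp A N s z) 0 s = N * evalOp r A := by
  have hsub : closedBall (0 : ℂ) s ⊆ ball 0 1 := closedBall_subset_ball hs1
  have dr := differentiableOn_evalAt hr
  have d1 : DifferentiableOn ℂ (fun z => evalAt r z • (conjResolvent A s z * N - N))
      (closedBall 0 s) :=
    (dr.mono hsub).smul (((differentiableOn_conjResolvent hs hρs hA).mul_const N).sub_const N)
  have h1 : circleAverage (fun z => evalAt r z • (conjResolvent A s z * N - N)) 0 s = 0 := by
    have : circleAverage (fun z => evalAt r z • (conjResolvent A s z * N - N)) 0 s =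
        evalAt r 0 • (conjResolvent A s 0 * N - N) := by
      refine DiffContOnCl.circleAverage (f := fun z => evalAt r z • (conjResolvent A s z * N - N)) ?_
      rw [abs_of_pos hs]
      exact d1.diffContOnCl_ball subset_rfl
    rw [this, conjResolvent_zero, one_mul, sub_self, smul_zero]
  have i1 := (d1.continuousOn.mono sphere_subset_closedBall).circleIntegrable hs.le
  have c2 : ContinuousOn (fun z : ℂ =>
      evalAt r z • (z • Ring.inverse (algebraMap ℂ (H →L[ℂ] H) z - A))) (sphere 0 s) :=
    (dr.continuousOn.mono (sphere_subset_closedBall.trans hsub)).smul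
      (differentiableOn_resolvent hρs hA).continuousOn
  have h2 := (ContinuousLinearMap.mul ℝ (H →L[ℂ] H) N).circleAverage_comp_comm
    (c2.circleIntegrable hs.le)
  have i2 : CircleIntegrable ((ContinuousLinearMap.mul ℝ (H →L[ℂ] H) N) ∘ fun z : ℂ =>
      evalAt r z • (z • Ring.inverse (algebraMap ℂ (H →L[ℂ] H) z - A))) 0 s :=
    (ContinuousOn.comp (ContinuousLinearMap.continuous _).continuousOn c2
      (Set.mapsTo_univ _ _)).circleIntegrable hs.le
  rw [circleAverage_evalAt_smul_resolvent hs hρs hs1 hA hr] at h2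
  have h3 := circleAverage_add i2 i1
  rw [h1, h2, add_zero] at h3
  change _ = N * evalOp r A at h3
  rw [← h3]
  congr 1
  ext1 z
  change _ = N * (evalAt r z • (z • Ring.inverse (algebraMap ℂ (H →L[ℂ] H) z - A))) +
    evalAt r z • (conjResolvent A s z * N - N)
  rw [poissonKernelOp, smul_add, mul_smul_comm (evalAt r z)]

/-- The Poisson kernel is positive when `A` is a contraction for `N`. -/
lemma exists_poissonKernelOp_eq_star_mul {A N : H →L[ℂ] H} {ρ s : ℝ} (hs : 0 < s)
    (hρs : ρ < s) (hA : ∀ x, ‖inner ℂ x (A x)‖ ≤ ρ * ‖x‖ ^ 2) (hN : IsSelfAdjoint N)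
    (hNA : ∀ x, (inner ℂ (A x) (N (A x))).re ≤ s ^ 2 * (inner ℂ x (N x)).re) {z : ℂ}
    (hz : ‖z‖ = s) : ∃ E, poissonKernelOp A N s z = star E * E := by
  have h1 : star A * N * A ≤ (s ^ 2 : ℝ) • N := by
    rw [le_iff_re_inner (hN.conjugate' A) ((IsSelfAdjoint.all _).smul hN)]
    intro x
    rw [smul_apply, ← Complex.coe_smul, inner_smul_right, Complex.re_ofReal_mul]
    refine le_trans (le_of_eq ?_) (hNA x)
    rw [← ContinuousLinearMap.adjoint_inner_right]
    rfl
  -- With `G = (z - A)⁻¹` the kernel equals `G* (s² N - A* N A) G`, so factoring the middle operator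
  -- as `D* D` gives `E = D G`.
  obtain ⟨D, hD⟩ := CStarAlgebra.nonneg_iff_eq_star_mul_self.mp (sub_nonneg.mpr h1)
  have hu := isUnit_algebraMap_sub hA (z := z) (by linarith)
  set G := Ring.inverse (algebraMap ℂ (H →L[ℂ] H) z - A) with hG
  refine ⟨D * G, ?_⟩
  have e1 : (algebraMap ℂ (H →L[ℂ] H) z - A) * G = 1 := Ring.mul_inverse_cancel _ hu
  have e2 : star G * (algebraMap ℂ (H →L[ℂ] H) (star z) - star A) = 1 := by
    have := congrArg star e1
    rwa [star_mul, star_sub, ← algebraMap_star_comm, star_one] at this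
  have e3 : z * star z = ((s ^ 2 : ℝ) : ℂ) := by
    rw [← hz]; push_cast; exact Complex.mul_conj' z
  rw [poissonKernelOp, conjResolvent_eq_star hs hρs hA hz, ← hG, star_mul,
    show star G * star D * (D * G) = star G * (star D * D) * G by simp only [mul_assoc], ← hD]
  simp only [Algebra.algebraMap_eq_smul_one] at e1 e2
  rw [← Complex.coe_smul, ← e3]
  set W := z • (1 : H →L[ℂ] H) - A with hW
  set W' := star z • (1 : H →L[ℂ] H) - star A with hW'
  have hAW : A = z • (1 : H →L[ℂ] H) - W := by rw [hW]; abel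
  have hAW' : star A = star z • (1 : H →L[ℂ] H) - W' := by rw [hW']; abel
  have e4 : (z * star z) • N - star A * N * A = z • (W' * N) + star z • (N * W) - W' * N * W := by
    rw [hAW', hAW]
    simp only [sub_mul, mul_sub, smul_mul_assoc, mul_smul_comm, one_mul, mul_one, smul_sub,
      smul_smul]
    abel
  rw [e4]
  simp only [mul_sub, mul_add, sub_mul, add_mul, mul_smul_comm, smul_mul_assoc, star_smul]
  have e5 : star G * (W' * N) * G = N * G := by rw [← mul_assoc, e2, one_mul]
  have e6 : star G * (N * W) * G = star G * N := by rw [mul_assoc, mul_assoc, e1, mul_one]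
  have e7 : star G * (W' * N * W) * G = N := by
    rw [mul_assoc W', ← mul_assoc (star G), e2, one_mul, mul_assoc, e1, mul_one]
  rw [e5, e6, e7]
  abel

end

/-! ### Von Neumann inequality in the metric. -/

section

variable {H : Type*} [NormedAddCommGroup H] [InnerProductSpace ℂ H]

open Real Metric

/-- The real-linear functional `T ↦ Re ⟨T h, k⟩`. -/
def reInnerL (k h : H) : (H →L[ℂ] H) →L[ℝ] ℝ :=
  Complex.reCLM ∘L ((innerSL ℂ k).restrictScalars ℝ) ∘L
    ((ContinuousLinearMap.apply ℂ H h).restrictScalars ℝ)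

lemma noPoleOn_one (Ω : Set ℂ) : NoPoleOn 1 Ω := fun z _ => by simp

lemma evalAt_one (z : ℂ) : evalAt 1 z = 1 := by simp [evalAt]

lemma evalOp_one (A : H →L[ℂ] H) : evalOp 1 A = 1 := by simp [evalOp]

/-- Compactness of the closure gives a maximal modulus below 1; an empty numerical range allows `ρ =
0`. -/
lemma exists_numericalRadius_bound {A : H →L[ℂ] H}
    (hA : closure (numericalRange A) ⊆ ball 0 1) :
    ∃ ρ : ℝ, 0 ≤ ρ ∧ ρ < 1 ∧ ∀ x, ‖inner ℂ x (A x)‖ ≤ ρ * ‖x‖ ^ 2 := by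
  have hc : IsCompact (closure (numericalRange A)) :=
    isCompact_of_isClosed_isBounded isClosed_closure (isBounded_ball.subset hA)
  obtain ⟨ρ, hρ0, hρ1, hρ⟩ : ∃ ρ : ℝ, 0 ≤ ρ ∧ ρ < 1 ∧ ∀ w ∈ numericalRange A, ‖w‖ ≤ ρ := by
    rcases (closure (numericalRange A)).eq_empty_or_nonempty with h | h
    · refine ⟨0, le_rfl, one_pos, fun w hw => ?_⟩
      have := subset_closure hw
      rw [h] at this
      exact this.elim
    · obtain ⟨w, hw, hmax⟩ := hc.exists_isMaxOn h continuous_norm.continuousOn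
      exact ⟨‖w‖, norm_nonneg _, mem_ball_zero_iff.mp (hA hw),
        fun v hv => hmax (subset_closure hv)⟩
  refine ⟨ρ, hρ0, hρ1, fun x => ?_⟩
  rcases eq_or_ne x 0 with rfl | hx
  · simp
  have hx' : ‖x‖ ≠ 0 := norm_ne_zero_iff.mpr hx
  have h1 := hρ _ ⟨((‖x‖⁻¹ : ℝ) : ℂ) • x, by simp [norm_smul, hx'], rfl⟩
  rw [map_smul, inner_smul_left, inner_smul_right, Complex.conj_ofReal, norm_mul, norm_mul,
    Complex.norm_real, Real.norm_eq_abs, abs_of_nonneg (by positivity)] at h1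
  have h2 : 0 < ‖x‖ := norm_pos_iff.mpr hx
  field_simp at h1
  linarith

open scoped Matrix.Norms.L2Operator in
/-- A matrix acts on tuples of vectors of a Hilbert space with its Euclidean operator norm. -/
lemma sum_norm_sq_sum_smul_le {m n : ℕ} {M : Matrix (Fin m) (Fin n) ℂ} (hM : ‖M‖ ≤ 1)
    (g : Fin n → H) : ∑ i, ‖∑ j, M i j • g j‖ ^ 2 ≤ ∑ j, ‖g j‖ ^ 2 := by
  have : FiniteDimensional ℂ (Submodule.span ℂ (Set.range g)) :=
    FiniteDimensional.span_of_finite ℂ (Set.finite_range g)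
  -- In an orthonormal basis of the span, `M` acts on each coordinate separately.
  set b := stdOrthonormalBasis ℂ (Submodule.span ℂ (Set.range g)) with hb
  set g' : Fin n → Submodule.span ℂ (Set.range g) := fun j =>
    ⟨g j, Submodule.subset_span (Set.mem_range_self j)⟩ with hg'
  have e1 : ∀ j, ‖g j‖ ^ 2 = ∑ l, ‖b.repr (g' j) l‖ ^ 2 := fun j => by
    rw [← EuclideanSpace.norm_sq_eq, LinearIsometryEquiv.norm_map]
    rfl
  have e2 : ∀ i, ‖∑ j, M i j • g j‖ ^ 2 = ∑ l, ‖∑ j, M i j * b.repr (g' j) l‖ ^ 2 := fun i => by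
    have : ‖∑ j, M i j • g j‖ = ‖∑ j, M i j • g' j‖ := by
      rw [Submodule.coe_norm]
      simp [hg']
    rw [this, ← b.repr.norm_map, EuclideanSpace.norm_sq_eq]
    simp
  simp only [e1, e2]
  rw [Finset.sum_comm, Finset.sum_comm (s := (Finset.univ : Finset (Fin n)))]
  refine Finset.sum_le_sum fun l _ => ?_
  have h1 := Matrix.l2_opNorm_mulVec M (WithLp.toLp 2 fun j => b.repr (g' j) l)
  have h2 := h1.trans (mul_le_of_le_one_left (norm_nonneg _) hM)
  have h3 := pow_le_pow_left₀ (norm_nonneg _) h2 2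
  rw [EuclideanSpace.norm_sq_eq, EuclideanSpace.norm_sq_eq] at h3
  simpa [Matrix.mulVec, dotProduct] using h3

variable [CompleteSpace H]

/-- The von Neumann inequality, in the metric `N`. -/
lemma sum_inner_metric_le {A N : H →L[ℂ] H} {ρ s : ℝ} (hs : 0 < s)
    (hρs : ρ < s) (hs1 : s < 1) (hA : ∀ x, ‖inner ℂ x (A x)‖ ≤ ρ * ‖x‖ ^ 2)
    (hN : IsSelfAdjoint N)
    (hNA : ∀ x, (inner ℂ (A x) (N (A x))).re ≤ s ^ 2 * (inner ℂ x (N x)).re)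
    {m n : ℕ} {R : Matrix (Fin m) (Fin n) (RatFunc ℂ)}
    (hR : ∀ i j, NoPoleOn (R i j) (ball 0 1))
    (hb : ∀ z ∈ ball (0 : ℂ) 1, ∀ g : Fin n → H,
      ∑ i, ‖∑ j, evalAt (R i j) z • g j‖ ^ 2 ≤ ∑ j, ‖g j‖ ^ 2) (h : Fin n → H) :
    ∑ i, (inner ℂ (∑ j, evalOp (R i j) A (h j)) (N (∑ j, evalOp (R i j) A (h j)))).re ≤
      ∑ j, (inner ℂ (h j) (N (h j))).re := by
  set k : Fin m → H := fun i => ∑ j, evalOp (R i j) A (h j) with hk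
  set P := poissonKernelOp A N s with hP
  have hsub : sphere (0 : ℂ) s ⊆ ball 0 1 :=
    sphere_subset_closedBall.trans (closedBall_subset_ball hs1)
  have cP : ContinuousOn P (sphere 0 s) := continuousOn_poissonKernelOp N hs hρs hA
  have avgR : ∀ (r : RatFunc ℂ), NoPoleOn r (ball 0 1) → ∀ x y : H,
      CircleIntegrable (fun z => (inner ℂ x (evalAt r z • P z y)).re) 0 s ∧
      circleAverage (fun z => (inner ℂ x (evalAt r z • P z y)).re) 0 s =
        (inner ℂ x (N (evalOp r A y))).re := by
    intro r hr x y
    have c : ContinuousOn (fun z => evalAt r z • P z) (sphere 0 s) :=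
      ((differentiableOn_evalAt hr).continuousOn.mono hsub).smul cP
    have e := (reInnerL x y).circleAverage_comp_comm (c.circleIntegrable hs.le)
    rw [circleAverage_evalAt_smul_poissonKernelOp N hs hρs hs1 hA hr] at e
    exact ⟨(ContinuousOn.comp (reInnerL x y).continuous.continuousOn c
      (Set.mapsTo_univ _ _)).circleIntegrable hs.le, e⟩
  have avgP : ∀ x : H, CircleIntegrable (fun z => (inner ℂ x (P z x)).re) 0 s ∧
      circleAverage (fun z => (inner ℂ x (P z x)).re) 0 s = (inner ℂ x (N x)).re := by
    intro x
    have := avgR 1 (noPoleOn_one _) x x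
    simpa only [evalAt_one, one_smul, evalOp_one, one_apply_eq_self] using this
  -- `F` and `Gk` have the same average, the squared metric norm of `k = R(A) h`. The pointwise
  -- bound `2F ≤ Gk + Gh`, from `P = E* E` and `‖R(z)‖ ≤ 1`, then leaves the average of `Gh` as an
  -- upper bound.
  set F : ℂ → ℝ := fun z => ∑ i, ∑ j, (inner ℂ (k i) (evalAt (R i j) z • P z (h j))).re
  set Gk : ℂ → ℝ := fun z => ∑ i, (inner ℂ (k i) (P z (k i))).re
  set Gh : ℂ → ℝ := fun z => ∑ j, (inner ℂ (h j) (P z (h j))).re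
  have iF' : ∀ i, CircleIntegrable
      (fun z => ∑ j, (inner ℂ (k i) (evalAt (R i j) z • P z (h j))).re) 0 s := fun i =>
    CircleIntegrable.fun_sum _ fun j _ => (avgR (R i j) (hR i j) (k i) (h j)).1
  have iF : CircleIntegrable F 0 s := CircleIntegrable.fun_sum _ fun i _ => iF' i
  have iGk : CircleIntegrable Gk 0 s := CircleIntegrable.fun_sum _ fun i _ => (avgP (k i)).1
  have iGh : CircleIntegrable Gh 0 s := CircleIntegrable.fun_sum _ fun i _ => (avgP (h i)).1
  have aF : circleAverage F 0 s = ∑ i, (inner ℂ (k i) (N (k i))).re := by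
    rw [circleAverage_fun_sum fun i _ => iF' i]
    refine Finset.sum_congr rfl fun i _ => ?_
    rw [circleAverage_fun_sum fun j _ => (avgR (R i j) (hR i j) (k i) (h j)).1]
    simp only [(avgR (R i _) (hR i _) (k i) _).2]
    rw [← Complex.re_sum, ← inner_sum, ← map_sum]
  have aGk : circleAverage Gk 0 s = ∑ i, (inner ℂ (k i) (N (k i))).re := by
    rw [circleAverage_fun_sum fun i _ => (avgP (k i)).1]
    simp only [(avgP _).2]
  have aGh : circleAverage Gh 0 s = ∑ i, (inner ℂ (h i) (N (h i))).re := by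
    rw [circleAverage_fun_sum fun i _ => (avgP (h i)).1]
    simp only [(avgP _).2]
  have hmono : circleAverage (fun z => F z + F z) 0 s ≤
      circleAverage (fun z => Gk z + Gh z) 0 s := by
    refine circleAverage_mono (iF.add iF) (iGk.add iGh) fun z hz => ?_
    rw [abs_of_pos hs] at hz
    have hz1 := hsub hz
    rw [mem_sphere_zero_iff_norm] at hz
    obtain ⟨E, hE⟩ := exists_poissonKernelOp_eq_star_mul hs hρs hA hN hNA hz
    have eP : ∀ x y : H, inner ℂ x (P z y) = inner ℂ (E x) (E y) := fun x y => by
      rw [hP, hE]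
      exact E.adjoint_inner_right x (E y)
    have eS : ∀ x : H, (inner ℂ x (P z x)).re = ‖E x‖ ^ 2 := fun x => by
      rw [eP]
      exact inner_self_eq_norm_sq (𝕜 := ℂ) (E x)
    have eF : ∀ i, ∑ j, (inner ℂ (k i) (evalAt (R i j) z • P z (h j))).re =
        (inner ℂ (E (k i)) (∑ j, evalAt (R i j) z • E (h j))).re := fun i => by
      simp only [inner_sum, Complex.re_sum, inner_smul_right, eP]
    have h1 : F z + F z ≤ ∑ i, (‖E (k i)‖ ^ 2 + ‖∑ j, evalAt (R i j) z • E (h j)‖ ^ 2) := by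
      rw [← two_mul, Finset.mul_sum]
      refine Finset.sum_le_sum fun i _ => ?_
      rw [eF i]
      have h2 : (inner ℂ (E (k i)) (∑ j, evalAt (R i j) z • E (h j))).re ≤
          ‖E (k i)‖ * ‖∑ j, evalAt (R i j) z • E (h j)‖ := re_inner_le_norm (𝕜 := ℂ) _ _
      nlinarith [sq_nonneg (‖E (k i)‖ - ‖∑ j, evalAt (R i j) z • E (h j)‖)]
    refine h1.trans ?_
    simp only [Gk, Gh, eS]
    rw [Finset.sum_add_distrib]
    exact add_le_add le_rfl (hb z hz1 fun j => E (h j))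
  rw [circleAverage_fun_add iF iF, circleAverage_fun_add iGk iGh, aF, aGk, aGh] at hmono
  linarith

/-- The disk is a complete `2`-spectral set for operators whose numerical range lies in it. -/
lemma sum_norm_sq_evalOp_le {A : H →L[ℂ] H} (hA : closure (numericalRange A) ⊆ ball 0 1)
    {m n : ℕ} {R : Matrix (Fin m) (Fin n) (RatFunc ℂ)}
    (hR : ∀ i j, NoPoleOn (R i j) (ball 0 1))
    (hb : ∀ z ∈ ball (0 : ℂ) 1, ∀ g : Fin n → H,
      ∑ i, ‖∑ j, evalAt (R i j) z • g j‖ ^ 2 ≤ ∑ j, ‖g j‖ ^ 2) (h : Fin n → H) :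
    ∑ i, ‖∑ j, evalOp (R i j) A (h j)‖ ^ 2 ≤ 4 * ∑ j, ‖h j‖ ^ 2 := by
  obtain ⟨ρ, hρ0, hρ1, hρ⟩ := exists_numericalRadius_bound hA
  obtain ⟨N, s, hρs, hs1, hN, hN1, hN2, hNA⟩ := exists_metric hρ0 hρ1 hρ
  have h1 := sum_inner_metric_le (hρ0.trans_lt hρs) hρs hs1 hρ hN hNA hR hb h
  have h2 := Finset.sum_le_sum fun i (_ : i ∈ Finset.univ) => hN1 (∑ j, evalOp (R i j) A (h j))
  have h3 := Finset.sum_le_sum fun j (_ : j ∈ Finset.univ) => hN2 (h j)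
  rw [← Finset.mul_sum] at h2 h3
  linarith

end

/-! ### Norm bounds and the extremal nilpotents. -/

section

variable {H : Type*} [NormedAddCommGroup H] [InnerProductSpace ℂ H]

open Real Metric

lemma matEvalOp_apply {m n : ℕ} (R : Matrix (Fin m) (Fin n) (RatFunc ℂ)) (A : H →L[ℂ] H)
    (h : PiLp 2 (fun _ : Fin n => H)) (i : Fin m) :
    matEvalOp R A h i = ∑ j, evalOp (R i j) A (h j) := by
  simp [matEvalOp]

lemma enorm_matEvalOp_le [CompleteSpace H] {A : H →L[ℂ] H}
    (hA : closure (numericalRange A) ⊆ ball 0 1)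
    {m n : ℕ} {R : Matrix (Fin m) (Fin n) (RatFunc ℂ)} (hR : MatBoundedByOneOn R (ball 0 1)) :
    ‖matEvalOp R A‖ₑ ≤ 2 := by
  have h1 : ‖matEvalOp R A‖ ≤ 2 := by
    refine ContinuousLinearMap.opNorm_le_bound _ (by norm_num) fun h => ?_
    have := sum_norm_sq_evalOp_le hA hR.1
      (fun z hz g => sum_norm_sq_sum_smul_le (hR.2 z hz) g) (fun j => h j)
    refine abs_le_of_sq_le_sq' ?_ (by positivity) |>.2
    rw [mul_pow, PiLp.norm_sq_eq_of_L2, PiLp.norm_sq_eq_of_L2]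
    simp only [matEvalOp_apply]
    norm_num
    exact this
  rw [← ofReal_norm]
  exact (ENNReal.ofReal_le_ofReal h1).trans (by simp)

lemma enorm_evalOp_le [CompleteSpace H] {A : H →L[ℂ] H}
    (hA : closure (numericalRange A) ⊆ ball 0 1)
    {r : RatFunc ℂ} (hr : NoPoleOn r (ball 0 1)) (hb : ∀ z ∈ ball (0 : ℂ) 1, ‖evalAt r z‖ ≤ 1) :
    ‖evalOp r A‖ₑ ≤ 2 := by
  have h1 : ‖evalOp r A‖ ≤ 2 := by
    refine ContinuousLinearMap.opNorm_le_bound _ (by norm_num) fun h => ?_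
    have := sum_norm_sq_evalOp_le hA (m := 1) (n := 1) (R := fun _ _ => r) (fun _ _ => hr)
      (fun z hz g => by
        simp only [Finset.univ_unique, Finset.sum_singleton, norm_smul]
        exact pow_le_pow_left₀ (by positivity)
          (mul_le_of_le_one_left (norm_nonneg _) (hb z hz)) 2) (fun _ => h)
    simp only [Finset.univ_unique, Finset.sum_singleton] at this
    refine abs_le_of_sq_le_sq' ?_ (by positivity) |>.2
    rw [mul_pow]
    norm_num
    exact this
  rw [← ofReal_norm]
  exact (ENNReal.ofReal_le_ofReal h1).trans (by simp)

/-- A multiple of a rank-one nilpotent operator has a disk as its numerical range. -/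
lemma closure_numericalRange_rankOne_subset {e f : H} (he : ‖e‖ = 1) (hf : ‖f‖ = 1)
    (hef : inner ℂ e f = 0) {t : ℝ} (ht0 : 0 ≤ t) (ht1 : t < 1) :
    closure (numericalRange ((2 * t : ℂ) • InnerProductSpace.rankOne ℂ f e)) ⊆ ball 0 1 := by
  have h : numericalRange ((2 * t : ℂ) • InnerProductSpace.rankOne ℂ f e) ⊆ closedBall 0 t := by
    rintro w ⟨x, hx, rfl⟩
    rw [mem_closedBall_zero_iff, smul_apply, InnerProductSpace.rankOne_apply, inner_smul_right,
      inner_smul_right, norm_mul, norm_mul (inner ℂ e x)]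
    have ho : Orthonormal ℂ ![e, f] := by
      simp [orthonormal_vecCons_iff, he, hf, hef]
    -- Bessel's inequality bounds the product of the two coefficients by 1/2.
    have hb := ho.sum_inner_products_le (s := Finset.univ) x
    simp only [Fin.sum_univ_two, Matrix.cons_val_zero, Matrix.cons_val_one, hx] at hb
    have h2 : ‖(2 * t : ℂ)‖ = 2 * t := by simp [abs_of_nonneg ht0]
    rw [h2, norm_inner_symm x f]
    nlinarith [sq_nonneg (‖inner ℂ e x‖ - ‖inner ℂ f x‖)]
  exact (closure_minimal h isClosed_closedBall).trans (closedBall_subset_ball ht1)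

lemma enorm_rankOne_ge {e f : H} (he : ‖e‖ = 1) (hf : ‖f‖ = 1) {t : ℝ} (ht0 : 0 ≤ t) :
    ENNReal.ofReal (2 * t) ≤ ‖(2 * t : ℂ) • InnerProductSpace.rankOne ℂ f e‖ₑ := by
  rw [← ofReal_norm]
  refine ENNReal.ofReal_le_ofReal ?_
  simp [norm_smul, he, hf, abs_of_nonneg ht0]

lemma evalOp_X (A : H →L[ℂ] H) : evalOp RatFunc.X A = A := by
  simp [evalOp]

lemma noPoleOn_X (Ω : Set ℂ) : NoPoleOn RatFunc.X Ω := fun z _ => by simp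

lemma evalAt_X (z : ℂ) : evalAt RatFunc.X z = z := by simp [evalAt]

/-- The nilpotent of norm 2 is itself inadmissible, its numerical range reaching the unit circle, so
the examples only approach 2. -/
lemma two_le_of_forall_ofReal_le {a : ℝ≥0∞}
    (h : ∀ t : ℝ, 0 ≤ t → t < 1 → ENNReal.ofReal (2 * t) ≤ a) : 2 ≤ a := by
  have h1 : Filter.Tendsto (fun t : ℝ => ENNReal.ofReal (2 * t)) (nhdsWithin 1 (Set.Iio 1))
      (nhds (ENNReal.ofReal (2 * 1))) :=
    (ENNReal.tendsto_ofReal ((continuous_const.mul continuous_id).tendsto 1)).mono_left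
      nhdsWithin_le_nhds
  have h2 : ENNReal.ofReal (2 * 1) = 2 := by simp
  rw [h2] at h1
  refine le_of_tendsto h1 ?_
  filter_upwards [Ioo_mem_nhdsLT (zero_lt_one (α := ℝ))] with t ht
  exact h t ht.1.le ht.2

lemma C_ball_two_le : C (ball 0 1) 2 ≤ 2 := by
  refine sSup_le ?_
  rintro c ⟨A, r, hA, hr, hb, rfl⟩
  exact enorm_evalOp_le hA hr hb

lemma Ccb_ball_le : Ccb.{u} (ball 0 1) ≤ 2 := by
  refine sSup_le ?_
  rintro c ⟨H, _, _, _, A, m, n, R, hA, hR, rfl⟩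
  exact enorm_matEvalOp_le hA hR

lemma two_le_C_ball_two : 2 ≤ C (ball 0 1) 2 := by
  refine two_le_of_forall_ofReal_le fun t ht0 ht1 => ?_
  set e : EuclideanSpace ℂ (Fin 2) := EuclideanSpace.single 0 1
  set f : EuclideanSpace ℂ (Fin 2) := EuclideanSpace.single 1 1
  have he : ‖e‖ = 1 := by simp [e]
  have hf : ‖f‖ = 1 := by simp [f]
  have hef : inner ℂ e f = 0 := by simp [e, f, EuclideanSpace.inner_single_left]
  refine (enorm_rankOne_ge he hf ht0).trans (le_sSup ⟨(Matrix.toEuclideanCLM (𝕜 := ℂ)).symm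
    ((2 * t : ℂ) • InnerProductSpace.rankOne ℂ f e), RatFunc.X, ?_, noPoleOn_X _, ?_, ?_⟩)
  · rw [StarAlgEquiv.apply_symm_apply]
    exact closure_numericalRange_rankOne_subset he hf hef ht0 ht1
  · intro z hz
    rw [evalAt_X]
    exact (mem_ball_zero_iff.mp hz).le
  · rw [StarAlgEquiv.apply_symm_apply, evalOp_X]

open scoped Matrix.Norms.L2Operator in
lemma matBoundedByOneOn_X :
    MatBoundedByOneOn (Matrix.of fun _ _ : Fin 1 => RatFunc.X)
      (ball 0 1) := by
  refine ⟨fun _ _ => noPoleOn_X _, fun z hz => ?_⟩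
  have : matEvalAt (Matrix.of fun _ _ : Fin 1 => RatFunc.X) z =
      Matrix.diagonal fun _ => z := by
    ext i j
    fin_cases i
    fin_cases j
    simp [matEvalAt, evalAt_X]
  rw [this, Matrix.l2_opNorm_diagonal]
  simpa using (mem_ball_zero_iff.mp hz).le

lemma enorm_le_enorm_matEvalOp_X (A : H →L[ℂ] H) :
    ‖A‖ₑ ≤ ‖matEvalOp (Matrix.of fun _ _ : Fin 1 => RatFunc.X) A‖ₑ := by
  rw [← ofReal_norm, ← ofReal_norm]
  refine ENNReal.ofReal_le_ofReal (A.opNorm_le_bound (norm_nonneg _) fun x => ?_)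
  have h := (matEvalOp (Matrix.of fun _ _ : Fin 1 => RatFunc.X) A).le_opNorm
    (WithLp.toLp 2 fun _ => x)
  have e1 : ∀ y : PiLp 2 (fun _ : Fin 1 => H), ‖y‖ = ‖y 0‖ := fun y => by
    simp [PiLp.norm_eq_of_L2]
  rw [e1, e1, matEvalOp_apply] at h
  simpa [evalOp_X] using h

lemma two_le_Ccb_ball : 2 ≤ Ccb.{u} (ball 0 1) := by
  refine two_le_of_forall_ofReal_le fun t ht0 ht1 => ?_
  -- The index type is lifted so that the space lies in universe `u`.
  set e : EuclideanSpace ℂ (ULift.{u} (Fin 2)) := EuclideanSpace.single ⟨0⟩ 1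
  set f : EuclideanSpace ℂ (ULift.{u} (Fin 2)) := EuclideanSpace.single ⟨1⟩ 1
  have he : ‖e‖ = 1 := by simp [e]
  have hf : ‖f‖ = 1 := by simp [f]
  have hef : inner ℂ e f = 0 := by simp [e, f, EuclideanSpace.inner_single_left]
  refine (enorm_rankOne_ge he hf ht0).trans ((enorm_le_enorm_matEvalOp_X _).trans
    (le_sSup ⟨_, inferInstance, inferInstance, inferInstance,
      (2 * t : ℂ) • InnerProductSpace.rankOne ℂ f e, 1, 1, _,
      closure_numericalRange_rankOne_subset he hf hef ht0 ht1, matBoundedByOneOn_X, rfl⟩))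

end

end NumRange

end

theorem mainTheorem3 :
    NumRange.Ccb.{u} (Metric.ball (0 : ℂ) 1) = NumRange.C (Metric.ball (0 : ℂ) 1) 2 ∧
      NumRange.C (Metric.ball (0 : ℂ) 1) 2 = 2 := by
  have h : NumRange.C (Metric.ball (0 : ℂ) 1) 2 = 2 :=
    le_antisymm NumRange.C_ball_two_le NumRange.two_le_C_ball_two
  refine ⟨?_, h⟩
  rw [h]
  exact le_antisymm NumRange.Ccb_ball_le NumRange.two_le_Ccb_ball
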